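/- Let $\rho>1$ and let $E_\rho\subset\mathbb C$ be the open Bernstein ellipse, i.e. the open ellipse with foci $\pm1$ whose semi-axes sum to $\rho$. Let $A(t)$ be $n\times n$ matrices and $\boldsymbol b(t)$ vectors of length $n$ (with real or complex entries) whose restrictions to $t\in[-1,1]$ admit extensions that are analytic on $E_\rho$ and continuous on $\overline{E_\rho}$, such that the extended $A(t)$ is invertible for every $t\in\overline{E_\rho}$. Put $\boldsymbol x(t)=A(t)^{-1}\boldsymbol b(t)$ and $\kappa_\rho=\max_{t\in\partial E_\rho}\|\boldsymbol x(t)\|_2$. Let $M\ge2$, $\Delta t=2/(M-1)$, and let $X=[\boldsymbol x(-1)\,|\,\boldsymbol x(-1+\Delta t)\,|\cdots|\,\boldsymbol x(1)]$ be the $n\times M$ history matrix at the $M$ equidistant times in $[-1,1]$. Let $t_i=1+\Delta t$ be the next time, set $r=(t_i+\sqrt{t_i^2-1})/\rho$, and assume $r<1$ (equivalently $t_i\in E_\rho$) and that $A(t_i)$, $\boldsymbol b(t_i)$ are the values of the extensions at $t_i$. Let $Q$ be an $n\times m$ matrix with orthonormal columns (for instance produced from $X$ by POD or by the randomized range finder)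 such that $\|(QQ^{*}-I)X\|_2\le\varepsilon$ for some $\varepsilon>0$, where $Q^{*}$ is the conjugate transpose ($Q^{*}=Q^T$ in the real case). Let $\boldsymbol s^{*}=Q\boldsymbol z^*$ be the initial guess, where $\boldsymbol z^*$ minimizes $\|A(t_i)Q\boldsymbol z-\boldsymbol b(t_i)\|_2$ over all vectors $\boldsymbol z$ of length $m$. Then, for every integer $R$ with $0\le R\le\frac12\sqrt{M-1}$, \[ \|A(t_i)\boldsymbol s^{*}-\boldsymbol b(t_i)\|_2\le 2\|A(t_i)\|_2\,\kappa_\rho\left[\frac1{1-r}+\frac{C(M,R)\,\rho}{\sqrt{\rho^2r^2-1}}\left(\frac1{\rho-1}+\frac{\varepsilon\rho^{R}}{2\sqrt M\,\kappa_\rho}\right)\right]r^{R+1}, \] where $C(M,R)=5\sqrt5\,\sqrt{2R+1}\,\sqrt M/\sqrt{2(M-1)}$. Here $\|\cdot\|_2$ is the Euclidean norm of vectors and the spectral norm of matrices. (If $\kappa_\rho=0$, the right-hand side is read as $0$.) -/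

import Mathlib

open scoped Matrix.Norms.L2Operator

noncomputable section

namespace CompressedGuess

open Matrix Set

/-- Euclidean norm of a coordinate vector. The norm of a matrix, written `‖A‖`, is the spectral
norm, by the scope `Matrix.Norms.L2Operator` opened above. -/
def euclNorm {K ι : Type*} [RCLike K] [Fintype ι] (v : ι → K) : ℝ :=
  ‖(WithLp.toLp 2 v : EuclideanSpace K ι)‖

/-- The open Bernstein ellipse: foci `±1`, semi-axes `(ρ + ρ⁻¹) / 2` and `(ρ - ρ⁻¹) / 2`, whose sum
is `ρ`. -/
def bernsteinEllipse (ρ : ℝ) : Set ℂ :=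
  {z : ℂ | ‖z - 1‖ + ‖z + 1‖ < ρ + ρ⁻¹}

/-- The solution `x` of `A x = b`, for an invertible matrix `A`. -/
def solution {K : Type*} [RCLike K] {n : ℕ} (A : Matrix (Fin n) (Fin n) K) (b : Fin n → K) :
    Fin n → K :=
  A⁻¹ *ᵥ b

/-- `A` and `b`, with real (`𝕜 = ℝ`) or complex (`𝕜 = ℂ`) entries, have on `[-1, 1]` the extensions
`Aext` and `bext`, which are analytic on the open Bernstein ellipse and continuous on the closed one,
and `Aext t` is invertible for every `t` in the closed ellipse. -/
structure HasAnalyticExtension {𝕜 : Type*} [RCLike 𝕜] {n : ℕ} (ρ : ℝ)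
    (A : ℝ → Matrix (Fin n) (Fin n) 𝕜) (b : ℝ → Fin n → 𝕜)
    (Aext : ℂ → Matrix (Fin n) (Fin n) ℂ) (bext : ℂ → Fin n → ℂ) : Prop where
  extends_matrix : ∀ t ∈ Icc (-1 : ℝ) 1, Aext t = (A t).map (RCLike.map 𝕜 ℂ)
  extends_rhs : ∀ t ∈ Icc (-1 : ℝ) 1, bext t = fun j => RCLike.map 𝕜 ℂ (b t j)
  analytic_matrix : AnalyticOnNhd ℂ Aext (bernsteinEllipse ρ)
  analytic_rhs : AnalyticOnNhd ℂ bext (bernsteinEllipse ρ)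
  continuous_matrix : ContinuousOn Aext (closure (bernsteinEllipse ρ))
  continuous_rhs : ContinuousOn bext (closure (bernsteinEllipse ρ))
  invertible : ∀ t ∈ closure (bernsteinEllipse ρ), IsUnit (Aext t)

/-- `κ_ρ`, the maximum of `‖x(t)‖₂` over the boundary of the Bernstein ellipse. -/
def kappa {n : ℕ} (ρ : ℝ) (Aext : ℂ → Matrix (Fin n) (Fin n) ℂ) (bext : ℂ → Fin n → ℂ) : ℝ :=
  sSup ((fun t => euclNorm (solution (Aext t) (bext t))) '' frontier (bernsteinEllipse ρ))

/-- The step `Δt = 2 / (M - 1)` of the uniform grid with `M` points on `[-1, 1]`. -/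
def timeStep (M : ℕ) : ℝ := 2 / ((M : ℝ) - 1)

/-- The `k`-th point of the uniform grid, `k = 0, …, M - 1`. -/
def equiTime (M : ℕ) (k : Fin M) : ℝ := -1 + (k : ℝ) * timeStep M

/-- The next time `t_i = 1 + Δt`. -/
def nextTime (M : ℕ) : ℝ := 1 + timeStep M

/-- The history matrix: its `k`-th column is the solution at the `k`-th grid point. -/
def historyMatrix {𝕜 : Type*} [RCLike 𝕜] {n : ℕ} (M : ℕ)
    (A : ℝ → Matrix (Fin n) (Fin n) 𝕜) (b : ℝ → Fin n → 𝕜) : Matrix (Fin n) (Fin M) 𝕜 :=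
  Matrix.of fun j k => solution (A (equiTime M k)) (b (equiTime M k)) j

/-- `s` is an element of the column space of `Q` that minimizes the residual `‖A s - b‖₂` over this
space: the initial guess computed from the basis `Q` for the linear system `A x = b`. -/
def IsInitialGuess {𝕜 : Type*} [RCLike 𝕜] {n m : ℕ} (A : Matrix (Fin n) (Fin n) 𝕜)
    (b : Fin n → 𝕜) (Q : Matrix (Fin n) (Fin m) 𝕜) (s : Fin n → 𝕜) : Prop :=
  ∃ z : Fin m → 𝕜, s = Q *ᵥ z ∧
    ∀ z' : Fin m → 𝕜, euclNorm (A *ᵥ (Q *ᵥ z) - b) ≤ euclNorm (A *ᵥ (Q *ᵥ z') - b)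

/-- `r = (t_i + √(t_i² - 1)) / ρ`. -/
def ratio (M : ℕ) (ρ : ℝ) : ℝ := (nextTime M + √(nextTime M ^ 2 - 1)) / ρ

/-- `C(M, R) = 5 √5 √(2R + 1) √M / √(2 (M - 1))`. -/
def constC (M R : ℕ) : ℝ :=
  5 * √5 * √(2 * (R : ℝ) + 1) * √(M : ℝ) / √(2 * ((M : ℝ) - 1))

end CompressedGuess

end

open scoped Matrix.Norms.L2Operator

namespace CompressedGuess

open Polynomial Set Filter Topology

/-! Write `τ = t_i + √(t_i² - 1) = ρ r`. For any weights `w`, the vector `X w` lies within `ε ‖w‖`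
of the column space of `Q`, so the minimal residual is at most `‖A(t_i)‖ (ε ‖w‖ + ‖x(t_i) - X w‖)`
(`residual_le_of_extrapolation`). It remains to extrapolate `x` stably from the grid to `t_i`.

Take `w` exact on polynomials of degree at most `R`. Then only the tail of the Chebyshev series of
`x` contributes to `x(t_i) - X w` (`exists_chebyshev_truncation`): it has size `r ^ (R + 1)` at
`t_i`, and size `ρ ^ (-(R + 1))` on the grid, where it is amplified by `∑ |w k| ≤ √M ‖w‖`.

By duality, such a `w` of norm at most `D` exists once `|P(t_i)| ≤ D (∑ P(t_k)²)^(1/2)` for all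
these polynomials (`exists_extrapolation_weights`). Chebyshev growth outside `[-1, 1]` costs a
factor `τ ^ R`. Since `R ≤ √(M - 1) / 2`, a Markov inequality keeps `|P|` above half its maximum at
sufficiently many grid points. -/

/-! ### Duality and polynomial inequalities on `[-1, 1]`. -/

/-- A functional dominated by the Euclidean norm of a linear image is represented by a vector. -/
theorem exists_weights_of_abs_le_norm {E ι : Type*} [AddCommGroup E] [Module ℝ E] [Fintype ι]
    (S : E →ₗ[ℝ] EuclideanSpace ℝ ι) (ℓ : E →ₗ[ℝ] ℝ) {D : ℝ} (hD : 0 ≤ D)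
    (h : ∀ p, |ℓ p| ≤ D * ‖S p‖) :
    ∃ w : EuclideanSpace ℝ ι, ‖w‖ ≤ D ∧ ∀ p, ℓ p = ∑ k, w k * S p k := by
  obtain ⟨g, hg⟩ := S.rangeRestrict.exists_rightInverse_of_surjective S.range_rangeRestrict
  have hSg : ∀ v, S (g v) = v := fun v => congrArg Subtype.val (LinearMap.congr_fun hg v)
  -- On the range of `S` the functional is bounded by `D`; Hahn–Banach extends it with the same
  -- norm, and Riesz represents the extension by `w`.
  let m : S.range →L[ℝ] ℝ := (ℓ ∘ₗ g).mkContinuous D fun v => by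
    have := h (g v)
    rw [hSg] at this
    simpa using this
  have hm : ‖m‖ ≤ D := LinearMap.mkContinuous_norm_le _ hD _
  obtain ⟨m', hm', hmn⟩ := exists_extension_norm_eq S.range m
  refine ⟨(InnerProductSpace.toDual ℝ _).symm m', ?_, fun p => ?_⟩
  · rw [LinearIsometryEquiv.norm_map, hmn]
    exact hm
  -- The hypothesis makes `ℓ` vanish on the kernel of `S`, so the choice of section `g` is
  -- immaterial.
  · have h0 : ℓ p = ℓ (g (S.rangeRestrict p)) := by
      have h1 := h (p - g (S.rangeRestrict p))
      rw [map_sub, map_sub, hSg] at h1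
      simpa [sub_eq_zero] using h1
    have h2 : ℓ p = m' (S p) := by
      rw [h0]
      exact (hm' (S.rangeRestrict p)).symm
    rw [h2, ← InnerProductSpace.toDual_symm_apply, PiLp.inner_apply]
    simp [mul_comm]

/-- Outside `[-1, 1]` the derivatives of a polynomial of degree at most `n` are dominated by those
of the Chebyshev polynomial. -/
theorem abs_eval_iterate_derivative_le {n : ℕ} {P : ℝ[X]} {K : ℝ} (hP : P.degree ≤ n)
    (hK : ∀ x ∈ Icc (-1 : ℝ) 1, |P.eval x| ≤ K) (k : ℕ) {x : ℝ} (hx : 1 ≤ x) :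
    |(derivative^[k] P).eval x| ≤ K * (derivative^[k] (Chebyshev.T ℝ n)).eval x := by
  have hK0 : 0 ≤ K := (abs_nonneg _).trans (hK 0 (by simp))
  rcases hK0.eq_or_lt with rfl | hKp
  · have hP0 : P = 0 := by
      refine Polynomial.eq_zero_of_infinite_isRoot P
        ((Icc_infinite (show (-1 : ℝ) < 1 by norm_num)).mono fun x hx => ?_)
      exact abs_nonpos_iff.mp (hK x hx)
    simp [hP0]
  · have key : ∀ s : ℝ, |s| = 1 →
        s * (derivative^[k] P).eval x ≤ K * (derivative^[k] (Chebyshev.T ℝ n)).eval x := by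
      intro s hs
      have h1 := Chebyshev.eval_iterate_derivative_le_of_forall_abs_le_one (n := n)
        (P := Polynomial.C (s * K⁻¹) * P) (k := k) hx
        ((degree_C_mul (mul_ne_zero (by rintro rfl; simp at hs) (inv_ne_zero hKp.ne'))).trans_le hP) (fun y hy => by
          rw [eval_mul, eval_C, abs_mul, abs_mul, hs, one_mul, abs_of_pos (inv_pos.2 hKp),
            inv_mul_le_one₀ hKp]
          exact hK y hy)
      rw [iterate_derivative_C_mul, eval_mul, eval_C] at h1
      calc s * (derivative^[k] P).eval x
          = K * (s * K⁻¹ * (derivative^[k] P).eval x) := by field_simp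
        _ ≤ _ := by gcongr
    refine abs_le'.2 ⟨by simpa using key 1 (by simp), by simpa using key (-1) (by simp)⟩

/-- A weak form of the Markov inequality. -/
theorem abs_eval_derivative_le {n : ℕ} {P : ℝ[X]} {K : ℝ} (hP : P.degree ≤ n)
    (hK : ∀ x ∈ Icc (-1 : ℝ) 1, |P.eval x| ≤ K) {x : ℝ} (hx : x ∈ Icc (-1 : ℝ) 1) :
    |(derivative P).eval x| ≤ 2 * (n : ℝ) ^ 2 * K := by
  wlog h0 : 0 ≤ x generalizing P x
  · have h1 := this (P := P.comp (-X)) (x := -x)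
      (by rw [degree_comp_neg_X]; exact hP)
      (fun y hy => by simpa using hK (-y) ⟨by linarith [hy.2], by linarith [hy.1]⟩)
      ⟨by linarith [hx.2], by linarith [hx.1]⟩ (by linarith)
    simpa [derivative_comp] using h1
  have hK0 : 0 ≤ K := (abs_nonneg _).trans (hK 0 (by simp))
  -- The map `y ↦ a y + a - 1` sends `[-1, 1]` onto `[-1, x]`, moving `x` to the endpoint `1`, where
  -- the extremal derivative is `T_n'(1) = n²`. The chain rule costs `1 / a ≤ 2`.
  set a : ℝ := (1 + x) / 2 with ha
  have ha2 : 1 / 2 ≤ a := by rw [ha]; linarith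
  have ha1 : a ≤ 1 := by rw [ha]; linarith [hx.2]
  have h1 := abs_eval_iterate_derivative_le (n := n)
    (P := P.comp (Polynomial.C a * X + Polynomial.C (a - 1)))
    (K := K) (by
      refine natDegree_le_iff_degree_le.1 (natDegree_comp_le.trans ?_)
      calc _ ≤ P.natDegree * 1 := by gcongr; exact natDegree_linear_le
        _ ≤ n := by rw [mul_one]; exact natDegree_le_iff_degree_le.2 hP)
    (fun y hy => by
      simp only [eval_comp, eval_add, eval_mul, eval_C, eval_X]
      refine hK _ ⟨?_, ?_⟩ <;> nlinarith [hy.1, hy.2]) 1 le_rfl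
  have hT : (derivative (Chebyshev.T ℝ n)).eval 1 = (n : ℝ) ^ 2 := by
    simp [Chebyshev.T_derivative_eq_U, sq]
  have hax : a + (a - 1) = x := by rw [ha]; ring
  simp only [Function.iterate_one, hT, derivative_comp, eval_mul, eval_comp, eval_add, eval_C,
    eval_X, mul_one, derivative_add, derivative_mul, derivative_C, derivative_X, hax, zero_mul,
    zero_add, add_zero, abs_mul] at h1
  rw [abs_of_pos (by linarith : 0 < a)] at h1
  nlinarith [abs_nonneg (eval x (derivative P))]

theorem eval_sub_le {n : ℕ} {P : ℝ[X]} {K : ℝ} (hP : P.degree ≤ n)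
    (hK : ∀ x ∈ Icc (-1 : ℝ) 1, |P.eval x| ≤ K) {x y : ℝ} (hx : x ∈ Icc (-1 : ℝ) 1)
    (hy : y ∈ Icc (-1 : ℝ) 1) : |P.eval y - P.eval x| ≤ 2 * (n : ℝ) ^ 2 * K * |y - x| :=
  (convex_Icc (-1 : ℝ) 1).norm_image_sub_le_of_norm_deriv_le (f := fun t => P.eval t)
    (fun _ _ => P.differentiableAt) (fun z hz => by
      rw [Polynomial.deriv]; exact abs_eval_derivative_le hP hK hz) hx hy

theorem eval_T_half_add_inv (n : ℕ) {z : ℂ} (hz : z ≠ 0) :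
    (Chebyshev.T ℂ n).eval ((z + z⁻¹) / 2) = (z ^ n + (z ^ n)⁻¹) / 2 := by
  have h := Chebyshev.T_complex_cosh (Complex.log z) n
  rw [Complex.cosh, Complex.cosh, Complex.exp_neg, Complex.exp_neg, Complex.exp_log hz] at h
  simpa [Complex.exp_nat_mul, Complex.exp_log hz] using h

theorem real_eval_T_half_add_inv (n : ℕ) {x : ℝ} (hx : x ≠ 0) :
    (Chebyshev.T ℝ n).eval ((x + x⁻¹) / 2) = (x ^ n + (x ^ n)⁻¹) / 2 := by
  have h := eval_T_half_add_inv n (z := (x : ℂ)) (by exact_mod_cast hx)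
  have h2 : (((x : ℂ) + (x : ℂ)⁻¹) / 2) = (((x + x⁻¹) / 2 : ℝ) : ℂ) := by push_cast; rfl
  rw [h2, ← Chebyshev.complex_ofReal_eval_T] at h
  exact_mod_cast h

theorem eval_T_le_pow (n : ℕ) {τ : ℝ} (hτ : 1 ≤ τ) :
    (Chebyshev.T ℝ n).eval ((τ + τ⁻¹) / 2) ≤ τ ^ n := by
  rw [real_eval_T_half_add_inv n (by positivity)]
  have h1 : 1 ≤ τ ^ n := one_le_pow₀ hτ
  have h2 : (τ ^ n)⁻¹ ≤ 1 := inv_le_one_of_one_le₀ h1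
  linarith

/-! ### Maximum norm against the discrete norm on the equispaced grid. -/

/-- A polynomial of degree at most `n` attains at least half of its maximum modulus `K` at `N` of
the equispaced points, provided these are dense enough. -/
theorem sum_sq_equiTime_ge_of_argmax {n M N : ℕ} (hM : 2 ≤ M) (hn : 1 ≤ n)
    (hn2 : 4 * n ^ 2 + 1 ≤ M) (hN : 1 ≤ N) (hNM : 8 * n ^ 2 * N + 1 ≤ M + 4 * n ^ 2)
    {P : ℝ[X]} {K : ℝ} (hP : P.degree ≤ n) (hK : ∀ x ∈ Icc (-1 : ℝ) 1, |P.eval x| ≤ K)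
    {c : ℝ} (hc : c ∈ Icc (-1 : ℝ) 1) (hcK : |P.eval c| = K) :
    N * (K / 2) ^ 2 ≤ ∑ k : Fin M, P.eval (equiTime M k) ^ 2 := by
  -- By reflection of the grid, the maximum lies in the left half, which leaves room for `N` grid
  -- points to its right.
  wlog h0 : c ≤ 0 generalizing P c
  · have h1 := this (P := P.comp (-X)) (c := -c)
      (by rw [degree_comp_neg_X]; exact hP)
      (fun y hy => by simpa using hK (-y) ⟨by linarith [hy.2], by linarith [hy.1]⟩)
      ⟨by linarith [hc.2], by linarith [hc.1]⟩ (by simpa using hcK) (by linarith)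
    rw [← Equiv.sum_comp Fin.revPerm] at h1
    convert h1 using 3 with k
    have hM1 : (M : ℝ) - 1 ≠ 0 := by
      have : (2 : ℝ) ≤ M := by exact_mod_cast hM
      linarith
    have hk : ((Fin.rev k : ℕ) : ℝ) = M - (k + 1) := by
      rw [Fin.val_rev, Nat.cast_sub (by omega)]; push_cast; ring
    simp only [eval_comp, eval_neg, eval_X, Fin.revPerm_apply, equiTime, timeStep, hk]
    congr 1
    field_simp
    ring
  have hK0 : 0 ≤ K := (abs_nonneg _).trans (hK 0 (by simp))
  have hMr : (2 : ℝ) ≤ M := by exact_mod_cast hM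
  have hnr : (1 : ℝ) ≤ n := by exact_mod_cast hn
  have hn2r : 4 * (n : ℝ) ^ 2 + 1 ≤ M := by exact_mod_cast hn2
  have hNr : (1 : ℝ) ≤ N := by exact_mod_cast hN
  have hNMr : 8 * (n : ℝ) ^ 2 * N + 1 ≤ M + 4 * (n : ℝ) ^ 2 := by exact_mod_cast hNM
  set x : ℝ := (c + 1) * (M - 1) / 2 with hx
  have hx0 : 0 ≤ x := by
    have := hc.1
    have : 0 ≤ (c + 1) * (M - 1 : ℝ) := mul_nonneg (by linarith) (by linarith)
    rw [hx]; linarith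
  have hxM : x ≤ (M - 1) / 2 := by
    rw [hx]; nlinarith
  -- `x` is the position of `c` in grid steps and `k₀` the nearest index, so `k₀, …, k₀ + N - 1` are
  -- within `N - 1/2` steps of `x`.
  set k₀ := ⌊x + 1 / 2⌋₊ with hk₀
  have hk1 : (k₀ : ℝ) ≤ x + 1 / 2 := Nat.floor_le (by linarith)
  have hk2 : x + 1 / 2 < k₀ + 1 := Nat.lt_floor_add_one _
  have hcx : c = -1 + x * (2 / (M - 1)) := by
    rw [hx]
    have : (M : ℝ) - 1 ≠ 0 := by linarith
    field_simp
    ring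
  have hbd : ∀ k ∈ Finset.Ico k₀ (k₀ + N), k < M ∧
      (K / 2) ^ 2 ≤ P.eval (-1 + (k : ℝ) * timeStep M) ^ 2 := by
    intro k hk
    rw [Finset.mem_Ico] at hk
    have hkl : (k₀ : ℝ) ≤ k := by exact_mod_cast hk.1
    have hku : (k : ℝ) + 1 ≤ k₀ + N := by exact_mod_cast hk.2
    have hkM : (k : ℝ) ≤ M - 1 := by
      have : (N : ℝ) - 1 / 2 ≤ (M - 1) / 8 := by
        nlinarith [mul_nonneg (by linarith : (0 : ℝ) ≤ N - 1 / 2)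
          (by nlinarith : (0 : ℝ) ≤ (n : ℝ) ^ 2 - 1)]
      linarith
    have hM1 : (0 : ℝ) < M - 1 := by linarith
    -- At this distance the Lipschitz constant `2 n² K` lets the polynomial drop by at most `K / 2`;
    -- `hNM` is precisely this requirement on `N`.
    have hdist : |(-1 + (k : ℝ) * timeStep M) - c| ≤ 1 / (4 * (n : ℝ) ^ 2) := by
      rw [hcx, timeStep, show -1 + (k : ℝ) * (2 / (M - 1)) - (-1 + x * (2 / (M - 1)))
        = (k - x) * (2 / (M - 1)) by ring, abs_mul, abs_of_pos (a := 2 / ((M : ℝ) - 1))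
        (by positivity)]
      have hkx : |(k : ℝ) - x| ≤ N - 1 / 2 := abs_le.2 ⟨by linarith, by linarith⟩
      calc |(k : ℝ) - x| * (2 / (M - 1)) ≤ (N - 1 / 2) * (2 / (M - 1)) := by gcongr
        _ ≤ _ := by
          rw [mul_div_assoc', div_le_div_iff₀ hM1 (by positivity)]
          nlinarith
    have hmem : (-1 + (k : ℝ) * timeStep M) ∈ Icc (-1 : ℝ) 1 := by
      have hk0 : (0 : ℝ) ≤ k := Nat.cast_nonneg k
      have h1 : (k : ℝ) * timeStep M ≤ 2 := by
        rw [timeStep, mul_div_assoc', div_le_iff₀ hM1]; linarith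
      have h2 : 0 ≤ (k : ℝ) * timeStep M := mul_nonneg hk0 (div_nonneg (by norm_num) hM1.le)
      exact ⟨by linarith, by linarith⟩
    refine ⟨by
      have : ((k : ℕ) : ℝ) < M := by linarith
      exact_mod_cast this, ?_⟩
    have h3 := eval_sub_le hP hK hc hmem
    have h4 : 2 * (n : ℝ) ^ 2 * K * |(-1 + (k : ℝ) * timeStep M) - c| ≤ K / 2 := by
      calc _ ≤ 2 * (n : ℝ) ^ 2 * K * (1 / (4 * (n : ℝ) ^ 2)) := by gcongr
        _ = K / 2 := by field_simp; ring
    have h5 : K / 2 ≤ |P.eval (-1 + (k : ℝ) * timeStep M)| := by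
      have := abs_sub_abs_le_abs_sub (P.eval c) (P.eval (-1 + (k : ℝ) * timeStep M))
      rw [abs_sub_comm] at h3
      linarith
    rw [← sq_abs (P.eval _)]
    gcongr
  have hsub : Finset.Ico k₀ (k₀ + N) ⊆ Finset.range M := fun k hk =>
    Finset.mem_range.2 (hbd k hk).1
  calc (N : ℝ) * (K / 2) ^ 2
      = (Finset.Ico k₀ (k₀ + N)).card • (K / 2) ^ 2 := by simp
    _ ≤ ∑ k ∈ Finset.Ico k₀ (k₀ + N), P.eval (-1 + (k : ℝ) * timeStep M) ^ 2 :=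
        Finset.card_nsmul_le_sum _ _ _ fun k hk => (hbd k hk).2
    _ ≤ ∑ k ∈ Finset.range M, P.eval (-1 + (k : ℝ) * timeStep M) ^ 2 :=
        Finset.sum_le_sum_of_subset_of_nonneg hsub fun _ _ _ => sq_nonneg _
    _ = _ := by rw [Finset.sum_range]; rfl

theorem sq_le_sum_sq_equiTime {R M : ℕ} (hM : 2 ≤ M) (hR : 4 * R ^ 2 + 1 ≤ M)
    {P : ℝ[X]} {K : ℝ} (hP : P.degree ≤ R) (hK : ∀ x ∈ Icc (-1 : ℝ) 1, |P.eval x| ≤ K)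
    {c : ℝ} (hc : c ∈ Icc (-1 : ℝ) 1) (hcK : |P.eval c| = K) :
    K ^ 2 ≤ 125 * (2 * R + 1) / (8 * √M) * ∑ k : Fin M, P.eval (equiTime M k) ^ 2 := by
  have hMr : (2 : ℝ) ≤ M := by exact_mod_cast hM
  have hs1 : 1 ≤ √(M : ℝ) := Real.one_le_sqrt.2 (by linarith)
  have hss : √(M : ℝ) * √(M : ℝ) = M := Real.mul_self_sqrt (by linarith)
  rcases Nat.eq_zero_or_pos R with rfl | hRpos
  · obtain ⟨a, rfl⟩ : ∃ a, P = Polynomial.C a :=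
      ⟨_, eq_C_of_degree_le_zero (by simpa using hP)⟩
    simp only [eval_C] at hcK ⊢
    rw [← hcK, sq_abs]
    simp only [Finset.sum_const, Finset.card_univ, Fintype.card_fin, nsmul_eq_mul,
      CharP.cast_eq_zero, mul_zero, zero_add, mul_one]
    rw [div_mul_eq_mul_div, le_div_iff₀ (by positivity)]
    have h1 : 8 * √(M : ℝ) ≤ 125 * M := by nlinarith
    nlinarith [mul_le_mul_of_nonneg_left h1 (sq_nonneg a)]
  -- The largest `N` allowed by `sum_sq_equiTime_ge_of_argmax`; the division is why `R = 0` was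
  -- treated apart.
  set N : ℕ := (M - 1 + 4 * R ^ 2) / (8 * R ^ 2) with hN
  have hR2 : 0 < 8 * R ^ 2 := by positivity
  have hN1 : 1 ≤ N := by
    rw [hN, Nat.one_le_div_iff hR2]; omega
  have hN2 : 8 * R ^ 2 * N + 1 ≤ M + 4 * R ^ 2 := by
    have := Nat.mul_div_le (M - 1 + 4 * R ^ 2) (8 * R ^ 2)
    rw [← hN] at this
    omega
  have hN3 : M ≤ 4 * R ^ 2 * (2 * N + 1) := by
    have := Nat.lt_mul_div_succ (M - 1 + 4 * R ^ 2) hR2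
    rw [← hN] at this
    have h2 : 8 * R ^ 2 * (N + 1) = 4 * R ^ 2 * (2 * N + 1) + 4 * R ^ 2 := by ring
    omega
  have h := sum_sq_equiTime_ge_of_argmax hM hRpos hR hN1 hN2 hP hK hc hcK
  have hNr : (1 : ℝ) ≤ N := by exact_mod_cast hN1
  have hRr : (1 : ℝ) ≤ R := by exact_mod_cast hRpos
  have hN3r : (M : ℝ) ≤ 4 * (R : ℝ) ^ 2 * (2 * N + 1) := by exact_mod_cast hN3
  -- From `M ≤ 4 R² (2 N + 1)` and `2 N + 1 ≤ 3 N²` one gets `√M ≤ √3 N (2 R + 1)`; the constant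
  -- `125` leaves slack, since `32 √3 < 125`.
  have hsN : 32 * √(M : ℝ) ≤ 125 * N * (2 * R + 1) := by
    refine abs_le_of_sq_le_sq' ?_ (by positivity) |>.2
    rw [mul_pow, Real.sq_sqrt (by linarith)]
    have h1 : 4 * (R : ℝ) ^ 2 * (2 * N + 1) ≤ (2 * R + 1) ^ 2 * (3 * N ^ 2) := by
      have : 2 * (N : ℝ) + 1 ≤ 3 * N ^ 2 := by nlinarith
      have h2 : 4 * (R : ℝ) ^ 2 ≤ (2 * R + 1) ^ 2 := by nlinarith
      gcongr
    nlinarith [sq_nonneg ((2 * R + 1) * N : ℝ)]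
  rw [div_mul_eq_mul_div, le_div_iff₀ (by positivity)]
  calc K ^ 2 * (8 * √M) = (32 * √M) * (K / 2) ^ 2 := by ring
    _ ≤ (125 * N * (2 * R + 1)) * (K / 2) ^ 2 := by gcongr
    _ = 125 * (2 * R + 1) * (N * (K / 2) ^ 2) := by ring
    _ ≤ _ := by gcongr

/-! ### Stable extrapolation from the grid to the next time. -/

/-- `t + √(t² - 1)`, the inverse Joukowski image of the next time. -/
noncomputable def nextRadius (M : ℕ) : ℝ := nextTime M + √(nextTime M ^ 2 - 1)

/-- Here `t_i² - 1 = 4 M / (M - 1)²`, so the square root is explicit. The last identity converts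
between `√(τ² - 1)` in the final bound and the power of `M` in the sampling inequality. -/
theorem nextTime_eq {M : ℕ} (hM : 2 ≤ M) :
    1 < nextRadius M ∧ nextTime M = (nextRadius M + (nextRadius M)⁻¹) / 2 ∧
      nextRadius M ^ 2 - 1 = nextRadius M * (4 * √M / (M - 1)) := by
  have hMr : (2 : ℝ) ≤ M := by exact_mod_cast hM
  have hM1 : (0 : ℝ) < M - 1 := by linarith
  have ht : nextTime M ^ 2 - 1 = (2 * √M / (M - 1)) ^ 2 := by
    rw [nextTime, timeStep, div_pow, mul_pow, Real.sq_sqrt (by linarith)]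
    field_simp
    ring
  have hq : 0 ≤ 2 * √M / (M - 1 : ℝ) := by positivity
  have hs : √(nextTime M ^ 2 - 1) = 2 * √M / (M - 1) := by rw [ht, Real.sqrt_sq hq]
  have ht1 : 1 < nextTime M := by
    rw [nextTime, timeStep]; have : 0 < 2 / ((M : ℝ) - 1) := by positivity
    linarith
  have h1 : 1 < nextRadius M := by rw [nextRadius, hs]; linarith
  have hinv : (nextRadius M)⁻¹ = nextTime M - 2 * √M / (M - 1) := by
    apply inv_eq_of_mul_eq_one_right
    rw [nextRadius, hs]
    linear_combination ht
  refine ⟨h1, ?_, ?_⟩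
  · rw [hinv, nextRadius, hs]; ring
  · have h2 : nextRadius M * (nextRadius M)⁻¹ = 1 := mul_inv_cancel₀ (by linarith)
    have h3 : nextRadius M - (nextRadius M)⁻¹ = 4 * √M / (M - 1) := by
      rw [hinv, nextRadius, hs]; ring
    rw [← h3]; linear_combination h2

/-- Both factors pass through the maximum of `|P|` on `[-1, 1]`: growth `T_R(t_i) ≤ τ ^ R` beyond
the interval, and the sampling inequality inside it. -/
theorem sq_eval_nextTime_le {R M : ℕ} (hM : 2 ≤ M) (hR : 4 * R ^ 2 + 1 ≤ M)
    {P : ℝ[X]} (hP : P.degree ≤ R) :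
    P.eval (nextTime M) ^ 2 ≤ (nextRadius M ^ R) ^ 2 * (125 * (2 * R + 1) / (8 * √M)) *
      ∑ k : Fin M, P.eval (equiTime M k) ^ 2 := by
  obtain ⟨c, hc, hmax⟩ := isCompact_Icc.exists_isMaxOn (nonempty_Icc.2 (by norm_num))
    (f := fun x : ℝ => |P.eval x|) (s := Icc (-1 : ℝ) 1) (by fun_prop)
  have hK : ∀ x ∈ Icc (-1 : ℝ) 1, |P.eval x| ≤ |P.eval c| := fun x hx => hmax hx
  obtain ⟨hτ, ht, -⟩ := nextTime_eq hM
  have h1 := sq_le_sum_sq_equiTime hM hR hP hK hc rfl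
  have ht1 : 1 ≤ nextTime M := by
    have hMr : (2 : ℝ) ≤ M := by exact_mod_cast hM
    rw [nextTime, timeStep]
    have : 0 < 2 / ((M : ℝ) - 1) := div_pos (by norm_num) (by linarith)
    linarith
  have h2 := abs_eval_iterate_derivative_le hP hK 0 ht1
  simp only [Function.iterate_zero, id] at h2
  have h3 : |P.eval (nextTime M)| ≤ nextRadius M ^ R * |P.eval c| := by
    refine h2.trans ?_
    rw [mul_comm]
    gcongr
    rw [ht]
    exact eval_T_le_pow R hτ.le
  calc P.eval (nextTime M) ^ 2 = |P.eval (nextTime M)| ^ 2 := (sq_abs _).symm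
    _ ≤ (nextRadius M ^ R * |P.eval c|) ^ 2 := by gcongr
    _ = (nextRadius M ^ R) ^ 2 * |P.eval c| ^ 2 := by ring
    _ ≤ _ := by rw [mul_assoc]; gcongr

/-- Stable extrapolation: there are weights, exact on polynomials of degree at most `R`, that
extrapolate from the grid to the next time. -/
theorem exists_extrapolation_weights {R M : ℕ} (hM : 2 ≤ M) (hR : 4 * R ^ 2 + 1 ≤ M) :
    ∃ w : EuclideanSpace ℝ (Fin M),
      ‖w‖ ≤ constC M R / √M * nextRadius M ^ (R + 1) / √(nextRadius M ^ 2 - 1) ∧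
      ∀ P : ℝ[X], P.degree ≤ R →
        P.eval (nextTime M) = ∑ k, w k * P.eval (equiTime M k) := by
  obtain ⟨hτ, -, hτ2⟩ := nextTime_eq hM
  have hMr : (2 : ℝ) ≤ M := by exact_mod_cast hM
  have hM1 : (0 : ℝ) < M - 1 := by linarith
  have hs : 0 < √(M : ℝ) := Real.sqrt_pos.2 (by linarith)
  set τ := nextRadius M
  set D : ℝ := constC M R / √M * τ ^ (R + 1) / √(τ ^ 2 - 1) with hD
  have hD0 : 0 ≤ D := by rw [hD, constC]; positivity
  have hD2 : (τ ^ R) ^ 2 * (125 * (2 * R + 1) / (8 * √M)) ≤ D ^ 2 := by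
    have hτ3 : 0 ≤ τ ^ 2 - 1 := by nlinarith
    -- `C(M, R)` matches the sampling constant up to one surplus factor `τ ≥ 1`.
    have hD3 : D ^ 2 = (τ ^ R) ^ 2 * (125 * (2 * R + 1) / (8 * √M)) * τ := by
      rw [hD, constC]
      simp only [div_pow, mul_pow]
      rw [Real.sq_sqrt hτ3, Real.sq_sqrt (by positivity : (0:ℝ) ≤ 5),
        Real.sq_sqrt (by positivity : (0:ℝ) ≤ 2 * R + 1),
        Real.sq_sqrt (by linarith : (0:ℝ) ≤ M), Real.sq_sqrt (by linarith : (0:ℝ) ≤ 2 * (M - 1)),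
        hτ2]
      have : τ ≠ 0 := by linarith
      field_simp
      ring
    rw [hD3]
    exact le_mul_of_one_le_right (by positivity) hτ.le
  let S : degreeLE ℝ R →ₗ[ℝ] EuclideanSpace ℝ (Fin M) :=
    { toFun := fun p => WithLp.toLp 2 fun k => (p : ℝ[X]).eval (equiTime M k)
      map_add' := fun p q => by ext k; simp
      map_smul' := fun a p => by ext k; simp }
  obtain ⟨w, hw, hwS⟩ := exists_weights_of_abs_le_norm S
    ((Polynomial.leval (nextTime M)).comp (degreeLE ℝ R).subtype) hD0 fun p => by
      have h := sq_eval_nextTime_le hM hR (mem_degreeLE.1 p.2)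
      have hn : ‖S p‖ ^ 2 = ∑ k : Fin M, (p : ℝ[X]).eval (equiTime M k) ^ 2 := by
        simp [EuclideanSpace.norm_sq_eq, S]
      refine abs_le_of_sq_le_sq ?_ (by positivity)
      rw [mul_pow, hn]
      refine h.trans ?_
      gcongr
  exact ⟨w, hw, fun P hP => hwS ⟨P, mem_degreeLE.2 hP⟩⟩

/-! ### Chebyshev series on the Bernstein ellipse, via Laurent series on an annulus. -/

/-- The Joukowski map. -/
noncomputable def joukowski (z : ℂ) : ℂ := (z + z⁻¹) / 2

theorem joukowski_inv (z : ℂ) : joukowski z⁻¹ = joukowski z := by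
  rw [joukowski, joukowski, inv_inv, add_comm]

/-- `joukowski z ∓ 1 = (z ∓ 1)² / (2 z)`, so the parallelogram law gives the sum of focal distances:
circles go to confocal ellipses. -/
theorem norm_joukowski_sub_one_add {z : ℂ} (hz : z ≠ 0) :
    ‖joukowski z - 1‖ + ‖joukowski z + 1‖ = ‖z‖ + ‖z‖⁻¹ := by
  have h1 : joukowski z - 1 = (z - 1) ^ 2 / (2 * z) := by rw [joukowski]; field_simp; ring
  have h2 : joukowski z + 1 = (z + 1) ^ 2 / (2 * z) := by rw [joukowski]; field_simp; ring
  have h3 := parallelogram_law_with_norm ℝ z 1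
  have hz' : ‖z‖ ≠ 0 := norm_ne_zero_iff.2 hz
  rw [h1, h2]
  simp only [norm_div, norm_pow, norm_mul, Complex.norm_ofNat]
  simp only [norm_one] at h3
  field_simp
  linarith

theorem joukowski_mem_bernsteinEllipse {ρ : ℝ} {z : ℂ} (h1 : ρ⁻¹ < ‖z‖) (h2 : ‖z‖ < ρ) :
    joukowski z ∈ bernsteinEllipse ρ := by
  have hρ : 0 < ρ := (norm_nonneg z).trans_lt h2
  have hz : 0 < ‖z‖ := (inv_pos.2 hρ).trans h1
  change ‖joukowski z - 1‖ + ‖joukowski z + 1‖ < ρ + ρ⁻¹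
  rw [norm_joukowski_sub_one_add (norm_pos_iff.1 hz)]
  have h3 : 1 < ‖z‖ * ρ := by rwa [inv_lt_iff_one_lt_mul₀ hρ] at h1
  have h4 : ρ + ρ⁻¹ - (‖z‖ + ‖z‖⁻¹) = (ρ - ‖z‖) * (‖z‖ * ρ - 1) / (‖z‖ * ρ) := by
    field_simp
    ring
  have h5 : 0 < (ρ - ‖z‖) * (‖z‖ * ρ - 1) / (‖z‖ * ρ) :=
    div_pos (mul_pos (by linarith) (by linarith)) (by positivity)
  linarith

theorem exists_norm_one_joukowski_eq {t : ℝ} (ht : t ∈ Icc (-1 : ℝ) 1) :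
    ∃ z : ℂ, ‖z‖ = 1 ∧ joukowski z = t := by
  refine ⟨Complex.exp (Real.arccos t * Complex.I), Complex.norm_exp_ofReal_mul_I _, ?_⟩
  rw [joukowski, ← Complex.exp_neg, ← neg_mul, ← Complex.cos, ← Complex.ofReal_cos,
    Real.cos_arccos ht.1 ht.2]

theorem equiTime_mem_Icc {M : ℕ} (hM : 2 ≤ M) (k : Fin M) : equiTime M k ∈ Icc (-1 : ℝ) 1 := by
  have hM1 : (0 : ℝ) < M - 1 := by
    have : (2 : ℝ) ≤ M := by exact_mod_cast hM
    linarith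
  have hk : ((k : ℕ) : ℝ) + 1 ≤ M := by exact_mod_cast k.2
  have h3 : (k : ℝ) * timeStep M ≤ 2 := by
    rw [timeStep, mul_div_assoc', div_le_iff₀ hM1]; linarith
  have h4 : 0 ≤ (k : ℝ) * timeStep M :=
    mul_nonneg (Nat.cast_nonneg _) (div_nonneg (by norm_num) hM1.le)
  rw [equiTime]
  exact ⟨by linarith, by linarith⟩

theorem norm_nextRadius {M : ℕ} (hM : 2 ≤ M) : ‖(nextRadius M : ℂ)‖ = nextRadius M := by
  rw [Complex.norm_real, Real.norm_of_nonneg (by linarith [(nextTime_eq hM).1])]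

theorem joukowski_nextRadius {M : ℕ} (hM : 2 ≤ M) : joukowski (nextRadius M) = nextTime M := by
  rw [(nextTime_eq hM).2.1, joukowski]
  push_cast
  rfl

theorem nextRadius_lt {M : ℕ} {ρ : ℝ} (hρ : 1 < ρ) (hr : ratio M ρ < 1) : nextRadius M < ρ := by
  have h : ratio M ρ = nextRadius M / ρ := rfl
  rwa [h, div_lt_one (by linarith)] at hr

/-- Cauchy's theorem between the two circles; `dz / z = i dθ` turns contour integrals into these
angular ones. -/
theorem integral_circle_eq_of_annulus {ρ : ℝ} (hρ : 1 < ρ) {g : ℂ → ℂ}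
    (hg : ∀ z : ℂ, ρ⁻¹ < ‖z‖ → ‖z‖ < ρ → DifferentiableAt ℂ g z) {s : ℝ} (hs1 : 1 ≤ s)
    (hs : s < ρ) (k : ℤ) :
    ∫ θ in (0)..(2 * Real.pi), g (circleMap 0 s θ) * circleMap 0 s θ ^ (-k) =
      ∫ θ in (0)..(2 * Real.pi), g (circleMap 0 1 θ) * circleMap 0 1 θ ^ (-k) := by
  have hρ1 : ρ⁻¹ < 1 := inv_lt_one_of_one_lt₀ hρ
  have hd : ∀ z : ℂ, 1 ≤ ‖z‖ → ‖z‖ ≤ s → DifferentiableAt ℂ (fun z => g z * z ^ (-k)) z :=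
    fun z h1 h2 => (hg z (by linarith) (by linarith)).mul
      (differentiableAt_zpow.2 (Or.inl (norm_pos_iff.1 (by linarith))))
  have h := Complex.circleIntegral_sub_center_inv_smul_eq_of_differentiable_on_annulus_off_countable
    (c := 0) (r := 1) (R := s) one_pos hs1 (f := fun z => g z * z ^ (-k)) (s := ∅)
    countable_empty
    (fun z hz => (hd z (by simpa using hz.2) (by simpa using hz.1)).continuousAt.continuousWithinAt)
    (fun z hz => hd z (by simpa using (not_le.1 (by simpa using hz.1.2) : (1 : ℝ) < ‖z‖).le)
      (by simpa using (mem_ball_zero_iff.1 hz.1.1).le))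
  have key : ∀ R : ℝ, R ≠ 0 → (∮ z in C(0, R), (z - 0)⁻¹ • (g z * z ^ (-k))) =
      Complex.I * ∫ θ in (0)..(2 * Real.pi), g (circleMap 0 R θ) * circleMap 0 R θ ^ (-k) := by
    intro R hR
    rw [circleIntegral, ← intervalIntegral.integral_const_mul]
    congr 1
    ext θ
    have : circleMap 0 R θ ≠ 0 := circleMap_ne_center hR
    rw [deriv_circleMap, sub_zero, smul_eq_mul, smul_eq_mul]
    field_simp
  rw [key s (by linarith), key 1 one_ne_zero] at h
  exact mul_left_cancel₀ Complex.I_ne_zero h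

/-- The Laurent coefficients, computed on the unit circle. -/
noncomputable def laurentCoeff (g : ℂ → ℂ) (k : ℤ) : ℂ :=
  (1 / (2 * Real.pi) : ℝ) *
    ∫ θ in (0)..(2 * Real.pi), g (circleMap 0 1 θ) * circleMap 0 1 θ ^ (-k)

theorem laurentCoeff_neg {g : ℂ → ℂ} (hsym : ∀ z, g z⁻¹ = g z) (k : ℤ) :
    laurentCoeff g (-k) = laurentCoeff g k := by
  rw [laurentCoeff, laurentCoeff]
  congr 1
  set f : ℝ → ℂ := fun θ => g (circleMap 0 1 θ) * circleMap 0 1 θ ^ (-k) with hf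
  have hper : Function.Periodic f (2 * Real.pi) := fun θ => by
    simp only [hf, periodic_circleMap 0 1 θ]
  have hneg : ∀ θ : ℝ, circleMap 0 1 (-θ) = (circleMap 0 1 θ)⁻¹ := fun θ => by
    simp [circleMap, Complex.exp_neg]
  have h1 : ∀ θ : ℝ, g (circleMap 0 1 θ) * circleMap 0 1 θ ^ (- -k) = f (-θ) := fun θ => by
    simp only [hf, hneg, hsym, inv_zpow, zpow_neg, inv_inv]
  simp_rw [h1]
  rw [intervalIntegral.integral_comp_neg]
  have h2 := hper.intervalIntegral_add_eq (-(2 * Real.pi)) 0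
  simpa using h2

theorem norm_laurentCoeff_le {ρ κ : ℝ} (hρ : 1 < ρ) {g : ℂ → ℂ}
    (hg : ∀ z : ℂ, ρ⁻¹ < ‖z‖ → ‖z‖ < ρ → DifferentiableAt ℂ g z)
    (hb : ∀ z : ℂ, ρ⁻¹ < ‖z‖ → ‖z‖ < ρ → ‖g z‖ ≤ κ) (k : ℕ) :
    ‖laurentCoeff g k‖ ≤ κ * ρ⁻¹ ^ k := by
  have hρ1 : ρ⁻¹ < 1 := inv_lt_one_of_one_lt₀ hρ
  -- The bound on `g` is only available inside the open annulus, so the Cauchy estimate is taken on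
  -- radius `s < ρ` and `s` then tends to `ρ`.
  have hs : ∀ s ∈ Ico 1 ρ, ‖laurentCoeff g k‖ * s ^ k ≤ κ := by
    intro s hs
    have hs0 : 0 < s := by linarith [hs.1]
    have h1 : ∀ θ ∈ Set.uIoc 0 (2 * Real.pi),
        ‖g (circleMap 0 s θ) * circleMap 0 s θ ^ (-(k : ℤ))‖ ≤ κ * (s ^ k)⁻¹ := by
      intro θ _
      have hn : ‖circleMap 0 s θ‖ = s := by simp [abs_of_pos hs0]
      rw [norm_mul, norm_zpow, hn, zpow_neg, zpow_natCast]
      gcongr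
      exact hb _ (by rw [hn]; linarith [hs.1]) (by rw [hn]; exact hs.2)
    have h2 := intervalIntegral.norm_integral_le_of_norm_le_const h1
    rw [laurentCoeff, ← integral_circle_eq_of_annulus hρ hg hs.1 hs.2, norm_mul,
      Complex.norm_real, Real.norm_of_nonneg (by positivity)]
    rw [sub_zero, abs_of_pos Real.two_pi_pos] at h2
    calc _ ≤ 1 / (2 * Real.pi) * (κ * (s ^ k)⁻¹ * (2 * Real.pi)) * s ^ k := by gcongr
      _ = κ := by
        have := Real.pi_ne_zero
        field_simp
  have hlim : Tendsto (fun s : ℝ => ‖laurentCoeff g k‖ * s ^ k) (𝓝[<] ρ)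
      (𝓝 (‖laurentCoeff g k‖ * ρ ^ k)) :=
    ((by fun_prop : Continuous fun s : ℝ => ‖laurentCoeff g k‖ * s ^ k).tendsto ρ).mono_left
      nhdsWithin_le_nhds
  have h3 := le_of_tendsto hlim (by
    filter_upwards [Ioo_mem_nhdsLT hρ] with s hs' using hs s ⟨hs'.1.le, hs'.2⟩)
  rw [inv_pow, ← div_eq_mul_inv, le_div_iff₀ (by positivity)]
  exact h3

/-- On the circle through `z` the Laurent series is a Fourier series with coefficients `c_k s ^ k`.
These are dominated by `κ (s / ρ) ^ |k|`, negative indices by symmetry, so the series converges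
pointwise. -/
theorem hasSum_laurentCoeff {ρ κ : ℝ} (hρ : 1 < ρ) {g : ℂ → ℂ}
    (hg : ∀ z : ℂ, ρ⁻¹ < ‖z‖ → ‖z‖ < ρ → DifferentiableAt ℂ g z)
    (hb : ∀ z : ℂ, ρ⁻¹ < ‖z‖ → ‖z‖ < ρ → ‖g z‖ ≤ κ) (hsym : ∀ z, g z⁻¹ = g z)
    {z : ℂ} (hz1 : 1 ≤ ‖z‖) (hz : ‖z‖ < ρ) :
    HasSum (fun k : ℤ => laurentCoeff g k * z ^ k) (g z) := by
  have hρ1 : ρ⁻¹ < 1 := inv_lt_one_of_one_lt₀ hρ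
  set s := ‖z‖ with hs
  have hs0 : 0 < s := by linarith
  have : Fact (0 < 2 * Real.pi) := ⟨Real.two_pi_pos⟩
  let F : C(AddCircle (2 * Real.pi), ℂ) :=
    ⟨fun θ => g ((s : ℂ) * AddCircle.toCircle θ), by
      refine continuous_iff_continuousAt.2 fun θ => ?_
      have hn : ‖(s : ℂ) * AddCircle.toCircle θ‖ = s := by
        rw [norm_mul, Circle.norm_coe, mul_one, Complex.norm_real, Real.norm_of_nonneg hs0.le]
      refine ContinuousAt.comp (g := g) (hg _ (by rw [hn]; linarith)
        (by rw [hn]; exact hz)).continuousAt ?_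
      have := (AddCircle.continuous_toCircle (T := 2 * Real.pi)).continuousAt (x := θ)
      fun_prop⟩
  have hF : ∀ θ : ℝ, F (θ : AddCircle (2 * Real.pi)) = g (circleMap 0 s θ) := fun θ => by
    change g ((s : ℂ) * AddCircle.toCircle (θ : AddCircle (2 * Real.pi))) = _
    rw [AddCircle.toCircle_apply_mk, circleMap, zero_add, Circle.coe_exp]
    congr 4
    have := Real.pi_ne_zero
    push_cast
    field_simp
  have hfour : ∀ (k : ℤ) (θ : ℝ), (s : ℂ) ^ k * fourier k (θ : AddCircle (2 * Real.pi)) =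
      circleMap 0 s θ ^ k := fun k θ => by
    rw [fourier_coe_apply, circleMap, zero_add, mul_zpow, ← Complex.exp_int_mul]
    congr 2
    have : (Real.pi : ℂ) ≠ 0 := by exact_mod_cast Real.pi_ne_zero
    push_cast
    field_simp
  have hsk : ∀ k : ℤ, (s : ℂ) ^ k ≠ 0 := fun k => zpow_ne_zero _ (by exact_mod_cast hs0.ne')
  have hcoef : ∀ k : ℤ, fourierCoeff F k = laurentCoeff g k * (s : ℂ) ^ k := by
    intro k
    rw [fourierCoeff_eq_intervalIntegral _ _ 0, laurentCoeff,
      ← integral_circle_eq_of_annulus hρ hg hz1 hz, zero_add, mul_assoc,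
      ← intervalIntegral.integral_mul_const, Complex.real_smul]
    congr 2
    ext θ
    rw [hF, ← hfour (-k) θ, smul_eq_mul, zpow_neg]
    have := hsk k
    field_simp
  have hr0 : 0 ≤ s / ρ := by positivity
  have hr1 : s / ρ < 1 := (div_lt_one (by linarith)).2 hz
  have hκ : 0 ≤ κ := (norm_nonneg _).trans (hb z (by linarith) hz)
  have hpos : ∀ n : ℕ, ‖laurentCoeff g n * (s : ℂ) ^ (n : ℤ)‖ ≤ κ * (s / ρ) ^ n := fun n => by
    rw [norm_mul, norm_zpow, Complex.norm_real, Real.norm_of_nonneg hs0.le, zpow_natCast,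
      div_pow, div_eq_mul_inv, ← inv_pow, mul_comm (s ^ n), ← mul_assoc]
    gcongr
    exact norm_laurentCoeff_le hρ hg hb n
  have hneg : ∀ n : ℕ, ‖laurentCoeff g (-n) * (s : ℂ) ^ (-n : ℤ)‖ ≤ κ * (s / ρ) ^ n := fun n => by
    refine le_trans ?_ (hpos n)
    rw [laurentCoeff_neg hsym, norm_mul, norm_mul, norm_zpow, norm_zpow, Complex.norm_real,
      Real.norm_of_nonneg hs0.le]
    gcongr
    · omega
  have hgeo := (summable_geometric_of_lt_one hr0 hr1).mul_left κ
  have hsum : Summable (fourierCoeff F) := by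
    have : fourierCoeff F = fun k : ℤ => laurentCoeff g k * (s : ℂ) ^ k := funext hcoef
    rw [this]
    exact Summable.of_nat_of_neg (Summable.of_norm_bounded hgeo hpos)
      (Summable.of_norm_bounded hgeo hneg)
  have h := has_pointwise_sum_fourier_series_of_summable hsum (z.arg : AddCircle (2 * Real.pi))
  have hzc : circleMap 0 s z.arg = z := by
    rw [circleMap, zero_add, hs, Complex.norm_mul_exp_arg_mul_I]
  rw [hF, hzc] at h
  convert h using 1
  ext k
  rw [hcoef, smul_eq_mul, mul_assoc, hfour, hzc]

/-- A function analytic on the Bernstein ellipse is approximated by its truncated Chebyshev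
series. -/
theorem exists_chebyshev_truncation {ρ κ : ℝ} (hρ : 1 < ρ) {F : ℂ → ℂ}
    (hF : ∀ t ∈ bernsteinEllipse ρ, DifferentiableAt ℂ F t)
    (hb : ∀ t ∈ bernsteinEllipse ρ, ‖F t‖ ≤ κ) (R : ℕ) :
    ∃ a : ℕ → ℂ, ∀ z : ℂ, 1 ≤ ‖z‖ → ‖z‖ < ρ →
      ‖∑ n ∈ Finset.range (R + 1), a n * (Chebyshev.T ℂ n).eval (joukowski z) - F (joukowski z)‖ ≤
        2 * κ * (‖z‖ / ρ) ^ (R + 1) / (1 - ‖z‖ / ρ) := by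
  have hρ1 : ρ⁻¹ < 1 := inv_lt_one_of_one_lt₀ hρ
  set g : ℂ → ℂ := fun z => F (joukowski z) with hgdef
  have hg : ∀ z : ℂ, ρ⁻¹ < ‖z‖ → ‖z‖ < ρ → DifferentiableAt ℂ g z := fun z h1 h2 => by
    have hz : z ≠ 0 := norm_pos_iff.1 ((inv_pos.2 (by linarith)).trans h1)
    refine DifferentiableAt.comp z (hF _ (joukowski_mem_bernsteinEllipse h1 h2)) ?_
    exact ((differentiableAt_id.add (differentiableAt_inv hz)).div_const 2)
  have hgb : ∀ z : ℂ, ρ⁻¹ < ‖z‖ → ‖z‖ < ρ → ‖g z‖ ≤ κ := fun z h1 h2 =>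
    hb _ (joukowski_mem_bernsteinEllipse h1 h2)
  have hsym : ∀ z, g z⁻¹ = g z := fun z => by simp only [hgdef, joukowski_inv]
  -- Symmetry `c_{-n} = c_n` and `z ^ n + z ^ (-n) = 2 T_n` pair the terms; index `0` is its own
  -- partner, so its coefficient is not doubled.
  refine ⟨fun n => if n = 0 then laurentCoeff g 0 else 2 * laurentCoeff g n, fun z hz1 hz => ?_⟩
  have hz0 : z ≠ 0 := norm_pos_iff.1 (by linarith)
  have h := hasSum_laurentCoeff hρ hg hgb hsym hz1 hz
  have hκ : 0 ≤ κ := (norm_nonneg _).trans (hgb z (by linarith) hz)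
  -- Folding the two-sided sum counts index `0` twice; one copy is removed.
  have h2 := h.nat_add_neg.sub (hasSum_ite_eq (0 : ℕ) (laurentCoeff g 0))
  have hterm : ∀ n : ℕ, (if n = 0 then laurentCoeff g 0 else 2 * laurentCoeff g n) *
      (Chebyshev.T ℂ n).eval (joukowski z) = laurentCoeff g n * z ^ (n : ℤ) +
        laurentCoeff g (-n) * z ^ (-n : ℤ) - if n = 0 then laurentCoeff g 0 else 0 := by
    intro n
    rw [joukowski, eval_T_half_add_inv n hz0, laurentCoeff_neg hsym, zpow_neg, zpow_natCast]
    rcases eq_or_ne n 0 with rfl | hn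
    · simp
    · simp only [hn, if_false]; ring
  have h3 : HasSum (fun n : ℕ => (if n = 0 then laurentCoeff g 0 else 2 * laurentCoeff g n) *
      (Chebyshev.T ℂ n).eval (joukowski z)) (F (joukowski z)) := by
    have h4 : g z + laurentCoeff g 0 * z ^ (0 : ℤ) - laurentCoeff g 0 = F (joukowski z) := by
      simp [hgdef]
    rw [← h4]
    exact h2.congr_fun hterm
  refine norm_sub_le_of_geometric_bound_of_hasSum ((div_lt_one (by linarith)).2 hz)
    (fun n => ?_) h3 (R + 1)
  have hcoef : ‖(if n = 0 then laurentCoeff g 0 else 2 * laurentCoeff g n)‖ ≤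
      2 * (κ * ρ⁻¹ ^ n) := by
    have h4 := norm_laurentCoeff_le hρ hg hgb n
    rcases eq_or_ne n 0 with rfl | hn
    · simp only [if_true]
      simp only [Nat.cast_zero, pow_zero, mul_one] at h4 ⊢
      linarith
    · simp only [hn, if_false, norm_mul, Complex.norm_ofNat]
      linarith
  have hT : ‖(Chebyshev.T ℂ n).eval (joukowski z)‖ ≤ ‖z‖ ^ n := by
    rw [joukowski, eval_T_half_add_inv n hz0, norm_div, Complex.norm_ofNat]
    have h5 : 1 ≤ ‖z‖ ^ n := one_le_pow₀ hz1
    have h6 : (‖z‖ ^ n)⁻¹ ≤ 1 := inv_le_one_of_one_le₀ h5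
    have h7 := norm_add_le (z ^ n) (z ^ n)⁻¹
    rw [norm_inv, norm_pow] at h7
    linarith
  rw [norm_mul]
  calc _ ≤ 2 * (κ * ρ⁻¹ ^ n) * ‖z‖ ^ n := by gcongr
    _ = _ := by rw [div_pow, inv_pow]; ring

/-- Extrapolation error for a scalar function analytic on the Bernstein ellipse. -/
theorem norm_sub_sum_le {ρ κ : ℝ} (hρ : 1 < ρ) {F : ℂ → ℂ}
    (hF : ∀ t ∈ bernsteinEllipse ρ, DifferentiableAt ℂ F t)
    (hb : ∀ t ∈ bernsteinEllipse ρ, ‖F t‖ ≤ κ) {R M : ℕ} (hM : 2 ≤ M)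
    (hr : ratio M ρ < 1) (w : Fin M → ℝ)
    (hw : ∀ P : ℝ[X], P.degree ≤ R →
      P.eval (nextTime M) = ∑ k, w k * P.eval (equiTime M k)) :
    ‖F (nextTime M) - ∑ k, (w k : ℂ) * F (equiTime M k)‖ ≤
      2 * κ * ratio M ρ ^ (R + 1) / (1 - ratio M ρ) +
        (∑ k, |w k|) * (2 * κ * ρ⁻¹ ^ (R + 1) / (1 - ρ⁻¹)) := by
  obtain ⟨a, ha⟩ := exists_chebyshev_truncation hρ hF hb R
  set p : ℂ → ℂ := fun t => ∑ n ∈ Finset.range (R + 1), a n * (Chebyshev.T ℂ n).eval t with hp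
  have hτ := (nextTime_eq hM).1
  have hratio : ratio M ρ = nextRadius M / ρ := rfl
  have h1 : ‖p (nextTime M) - F (nextTime M)‖ ≤
      2 * κ * ratio M ρ ^ (R + 1) / (1 - ratio M ρ) := by
    have hn := norm_nextRadius hM
    have h := ha (nextRadius M) (by rw [hn]; exact hτ.le) (by rw [hn]; exact nextRadius_lt hρ hr)
    rwa [joukowski_nextRadius hM, hn, ← hratio] at h
  have h2 : ∀ k : Fin M, ‖p (equiTime M k) - F (equiTime M k)‖ ≤
      2 * κ * ρ⁻¹ ^ (R + 1) / (1 - ρ⁻¹) := by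
    intro k
    obtain ⟨z, hz, hJ⟩ := exists_norm_one_joukowski_eq (equiTime_mem_Icc hM k)
    have h := ha z hz.ge (by rwa [hz])
    rwa [hJ, hz, one_div] at h
  -- Exactness holds for real polynomials; it is applied to each real `T_n` and extended to the
  -- complex coefficients by linearity.
  have h3 : p (nextTime M) = ∑ k, (w k : ℂ) * p (equiTime M k) := by
    simp only [hp, Finset.mul_sum]
    rw [Finset.sum_comm]
    refine Finset.sum_congr rfl fun n hn => ?_
    have hdeg : (Chebyshev.T ℝ n).degree ≤ R := by
      rw [Chebyshev.degree_T]
      have := Finset.mem_range.1 hn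
      simp only [Int.natAbs_natCast, Nat.cast_le]
      omega
    rw [← Chebyshev.complex_ofReal_eval_T, hw _ hdeg]
    push_cast
    rw [Finset.mul_sum]
    refine Finset.sum_congr rfl fun k _ => ?_
    ring
  have h4 : F (nextTime M) - ∑ k, (w k : ℂ) * F (equiTime M k) =
      -(p (nextTime M) - F (nextTime M)) +
        ∑ k, (w k : ℂ) * (p (equiTime M k) - F (equiTime M k)) := by
    simp only [mul_sub, Finset.sum_sub_distrib, ← h3]
    ring
  rw [h4]
  refine (norm_add_le _ _).trans ?_
  rw [norm_neg]
  refine add_le_add h1 ((norm_sum_le _ _).trans ?_)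
  rw [Finset.sum_mul]
  refine Finset.sum_le_sum fun k _ => ?_
  rw [norm_mul, Complex.norm_real, Real.norm_eq_abs]
  gcongr
  exact h2 k

open Matrix

/-! ### Transfer between `𝕜` and `ℂ`. -/

section Transfer

variable (𝕜 : Type*) [RCLike 𝕜]

/-- The canonical embedding of `ℝ` or `ℂ` into `ℂ` as a ring homomorphism. -/
noncomputable def toComplexHom : 𝕜 →+* ℂ where
  toFun := RCLike.map 𝕜 ℂ
  map_zero' := map_zero _
  map_add' := map_add _
  map_one' := by simp
  map_mul' a b := by
    apply Complex.ext
    · simp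
    · simp

theorem norm_toComplexHom (a : 𝕜) : ‖toComplexHom 𝕜 a‖ = ‖a‖ := by
  refine (sq_eq_sq₀ (norm_nonneg _) (norm_nonneg _)).1 ?_
  rw [← RCLike.normSq_eq_def', ← RCLike.normSq_eq_def', RCLike.normSq_apply, RCLike.normSq_apply]
  simp [toComplexHom]

end Transfer

theorem euclNorm_comp_toComplexHom {𝕜 : Type*} [RCLike 𝕜] {n : ℕ} (v : Fin n → 𝕜) :
    euclNorm (fun j => toComplexHom 𝕜 (v j)) = euclNorm v := by
  simp [euclNorm, EuclideanSpace.norm_eq, norm_toComplexHom]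

theorem isUnit_of_map_toComplexHom {𝕜 : Type*} [RCLike 𝕜] {n : ℕ}
    {A : Matrix (Fin n) (Fin n) 𝕜} (hA : IsUnit (A.map (toComplexHom 𝕜))) : IsUnit A := by
  rw [Matrix.isUnit_iff_isUnit_det, isUnit_iff_ne_zero] at hA ⊢
  intro h
  apply hA
  have := RingHom.map_det (toComplexHom 𝕜) A
  rw [h, map_zero] at this
  exact this.symm

theorem solution_map_toComplexHom {𝕜 : Type*} [RCLike 𝕜] {n : ℕ}
    {A : Matrix (Fin n) (Fin n) 𝕜} (hA : IsUnit A) (b : Fin n → 𝕜) :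
    solution (A.map (toComplexHom 𝕜)) (fun j => toComplexHom 𝕜 (b j)) =
      fun j => toComplexHom 𝕜 (solution A b j) := by
  have hinv : (A.map (toComplexHom 𝕜))⁻¹ = A⁻¹.map (toComplexHom 𝕜) := by
    apply Matrix.inv_eq_right_inv
    rw [← Matrix.map_mul, Matrix.mul_nonsing_inv _ ((Matrix.isUnit_iff_isUnit_det _).1 hA)]
    simp
  ext j
  rw [solution, hinv]
  exact (RingHom.map_mulVec (toComplexHom 𝕜) A⁻¹ b j).symm

/-! ### The extended solution on the ellipse. -/

theorem isOpen_bernsteinEllipse (ρ : ℝ) : IsOpen (bernsteinEllipse ρ) :=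
  isOpen_lt (by fun_prop) continuous_const

theorem isBounded_bernsteinEllipse (ρ : ℝ) : Bornology.IsBounded (bernsteinEllipse ρ) := by
  refine (Metric.isBounded_closedBall (x := (1 : ℂ)) (r := ρ + ρ⁻¹)).subset fun z hz => ?_
  have h : ‖z - 1‖ + ‖z + 1‖ < ρ + ρ⁻¹ := hz
  rw [mem_closedBall_iff_norm]
  linarith [norm_nonneg (z + 1)]

theorem ofReal_mem_bernsteinEllipse {ρ : ℝ} (hρ : 1 < ρ) {t : ℝ} (ht : t ∈ Icc (-1 : ℝ) 1) :
    (t : ℂ) ∈ bernsteinEllipse ρ := by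
  obtain ⟨z, hz, hJ⟩ := exists_norm_one_joukowski_eq ht
  rw [← hJ]
  exact joukowski_mem_bernsteinEllipse (by rw [hz]; exact inv_lt_one_of_one_lt₀ hρ) (by rwa [hz])

theorem nextTime_mem_bernsteinEllipse {M : ℕ} {ρ : ℝ} (hM : 2 ≤ M) (hρ : 1 < ρ)
    (hr : ratio M ρ < 1) : (nextTime M : ℂ) ∈ bernsteinEllipse ρ := by
  have hn := norm_nextRadius hM
  rw [← joukowski_nextRadius hM]
  exact joukowski_mem_bernsteinEllipse
    (by rw [hn]; linarith [inv_lt_one_of_one_lt₀ hρ, (nextTime_eq hM).1])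
    (by rw [hn]; exact nextRadius_lt hρ hr)

section Extension

variable {n : ℕ} {ρ : ℝ} {Aext : ℂ → Matrix (Fin n) (Fin n) ℂ} {bext : ℂ → Fin n → ℂ}

/-- The extended solution, as a map into Euclidean space. -/
noncomputable def solutionMap (Aext : ℂ → Matrix (Fin n) (Fin n) ℂ) (bext : ℂ → Fin n → ℂ)
    (t : ℂ) : EuclideanSpace ℂ (Fin n) :=
  WithLp.toLp 2 (solution (Aext t) (bext t))

theorem diffContOnCl_solutionMap
    (hA : AnalyticOnNhd ℂ Aext (bernsteinEllipse ρ)) (hb : AnalyticOnNhd ℂ bext (bernsteinEllipse ρ))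
    (hAc : ContinuousOn Aext (closure (bernsteinEllipse ρ)))
    (hbc : ContinuousOn bext (closure (bernsteinEllipse ρ)))
    (hinv : ∀ t ∈ closure (bernsteinEllipse ρ), IsUnit (Aext t)) :
    DiffContOnCl ℂ (solutionMap Aext bext) (bernsteinEllipse ρ) := by
  have heq : solutionMap Aext bext = fun t =>
      WithLp.toLp 2 ((Ring.inverse (Aext t)) *ᵥ bext t) := by
    ext t
    rw [solutionMap, solution, Matrix.nonsing_inv_eq_ringInverse]
  have hentry : ∀ i j : Fin n, Differentiable ℂ fun B : Matrix (Fin n) (Fin n) ℂ => B i j :=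
    fun i j => (LinearMap.toContinuousLinearMap (Matrix.entryLinearMap ℂ ℂ i j)).differentiable
  have hentryc : ∀ i j : Fin n, Continuous fun B : Matrix (Fin n) (Fin n) ℂ => B i j :=
    fun i j => (hentry i j).continuous
  rw [heq]
  constructor
  · intro t ht
    have h1 : DifferentiableAt ℂ (fun t => Ring.inverse (Aext t)) t :=
      (differentiableAt_inverse (hinv t (subset_closure ht))).comp t (hA t ht).differentiableAt
    have h2 : DifferentiableAt ℂ bext t := (hb t ht).differentiableAt
    refine DifferentiableAt.differentiableWithinAt ?_
    rw [differentiableAt_euclidean]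
    intro i
    simp only [mulVec, dotProduct]
    refine DifferentiableAt.fun_sum fun j _ => ?_
    exact ((hentry i j).differentiableAt.comp t h1).mul (differentiableAt_pi.1 h2 j)
  · intro t ht
    have h1 : ContinuousWithinAt (fun t => Ring.inverse (Aext t))
        (closure (bernsteinEllipse ρ)) t := by
      have h3 : ContinuousAt Ring.inverse (Aext t) :=
        (differentiableAt_inverse (𝕜 := ℂ) (hinv t ht)).continuousAt
      exact h3.comp_continuousWithinAt (hAc t ht)
    have h2 := hbc t ht
    refine (PiLp.continuous_toLp 2 _).continuousAt.comp_continuousWithinAt ?_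
    refine continuousWithinAt_pi.2 fun i => ?_
    simp only [mulVec, dotProduct]
    refine tendsto_finsetSum _ fun j _ => ?_
    exact ((hentryc i j).continuousAt.comp_continuousWithinAt h1).mul (continuousWithinAt_pi.1 h2 j)

/-- Maximum modulus principle; compactness of the frontier makes the supremum in `kappa` a genuine
upper bound. -/
theorem norm_solutionMap_le_kappa
    (hd : DiffContOnCl ℂ (solutionMap Aext bext) (bernsteinEllipse ρ)) {t : ℂ}
    (ht : t ∈ bernsteinEllipse ρ) : ‖solutionMap Aext bext t‖ ≤ kappa ρ Aext bext := by
  refine Complex.norm_le_of_forall_mem_frontier_norm_le (isBounded_bernsteinEllipse ρ) hd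
    (fun z hz => ?_) (subset_closure ht)
  have hcpt : IsCompact (frontier (bernsteinEllipse ρ)) :=
    Metric.isCompact_of_isClosed_isBounded isClosed_frontier
      ((isBounded_bernsteinEllipse ρ).closure.subset frontier_subset_closure)
  have hc : ContinuousOn (fun t => ‖solutionMap Aext bext t‖) (frontier (bernsteinEllipse ρ)) :=
    (hd.2.mono frontier_subset_closure).norm
  exact le_csSup (hcpt.image_of_continuousOn hc).bddAbove (mem_image_of_mem _ hz)

theorem norm_solutionMap_sub_sum_le (hρ : 1 < ρ)
    (hd : DiffContOnCl ℂ (solutionMap Aext bext) (bernsteinEllipse ρ)) {R M : ℕ} (hM : 2 ≤ M)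
    (hr : ratio M ρ < 1) (w : Fin M → ℝ)
    (hw : ∀ P : ℝ[X], P.degree ≤ R →
      P.eval (nextTime M) = ∑ k, w k * P.eval (equiTime M k)) :
    ‖solutionMap Aext bext (nextTime M) -
        ∑ k, (w k : ℂ) • solutionMap Aext bext (equiTime M k)‖ ≤
      2 * kappa ρ Aext bext * ratio M ρ ^ (R + 1) / (1 - ratio M ρ) +
        (∑ k, |w k|) * (2 * kappa ρ Aext bext * ρ⁻¹ ^ (R + 1) / (1 - ρ⁻¹)) := by
  have hρ1 : ρ⁻¹ < 1 := inv_lt_one_of_one_lt₀ hρ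
  have hκ : 0 ≤ kappa ρ Aext bext := (norm_nonneg _).trans
    (norm_solutionMap_le_kappa hd (nextTime_mem_bernsteinEllipse hM hρ hr))
  have hr0 : 0 ≤ ratio M ρ := by
    have := (nextTime_eq hM).1
    have h2 : ratio M ρ = nextRadius M / ρ := rfl
    rw [h2]; positivity
  -- Testing against functionals `f` reduces to the scalar estimate with bound `‖f‖ κ`, with no
  -- dimension factor as entrywise estimates would give.
  refine NormedSpace.norm_le_dual_bound ℂ _ ?_ fun f => ?_
  · have h1 : 0 < 1 - ratio M ρ := by linarith
    have h2 : 0 < 1 - ρ⁻¹ := by linarith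
    have h3 : 0 < ρ⁻¹ := inv_pos.2 (by linarith)
    positivity
  · have h := norm_sub_sum_le (F := fun t => f (solutionMap Aext bext t))
      (κ := ‖f‖ * kappa ρ Aext bext) hρ
      (fun t ht => f.differentiableAt.comp t
        (hd.1.differentiableAt ((isOpen_bernsteinEllipse ρ).mem_nhds ht)))
      (fun t ht => (f.le_opNorm _).trans (by
        gcongr; exact norm_solutionMap_le_kappa hd ht)) hM hr w hw
    simp only [map_sub, map_sum, map_smul, smul_eq_mul]
    refine h.trans_eq ?_
    ring

end Extension

/-! ### The residual estimate and the final assembly. -/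

theorem euclNorm_mulVec_le {𝕜 : Type*} [RCLike 𝕜] {m n : ℕ} (A : Matrix (Fin m) (Fin n) 𝕜)
    (v : Fin n → 𝕜) : euclNorm (A *ᵥ v) ≤ ‖A‖ * euclNorm v :=
  Matrix.l2_opNorm_mulVec A (WithLp.toLp 2 v)

theorem euclNorm_add_le {𝕜 : Type*} [RCLike 𝕜] {n : ℕ} (u v : Fin n → 𝕜) :
    euclNorm (u + v) ≤ euclNorm u + euclNorm v :=
  norm_add_le (WithLp.toLp 2 u : EuclideanSpace 𝕜 (Fin n)) (WithLp.toLp 2 v)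

theorem euclNorm_neg {𝕜 : Type*} [RCLike 𝕜] {n : ℕ} (v : Fin n → 𝕜) :
    euclNorm (-v) = euclNorm v :=
  norm_neg (WithLp.toLp 2 v : EuclideanSpace 𝕜 (Fin n))

theorem mulVec_solution {𝕜 : Type*} [RCLike 𝕜] {n : ℕ} {A : Matrix (Fin n) (Fin n) 𝕜}
    (hA : IsUnit A) (b : Fin n → 𝕜) : A *ᵥ solution A b = b := by
  rw [solution, mulVec_mulVec, Matrix.mul_nonsing_inv _ ((Matrix.isUnit_iff_isUnit_det _).1 hA),
    one_mulVec]

theorem sum_abs_le_sqrt_mul_norm {M : ℕ} (w : EuclideanSpace ℝ (Fin M)) :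
    ∑ k, |w k| ≤ √M * ‖w‖ := by
  refine abs_le_of_sq_le_sq' ?_ (by positivity) |>.2
  rw [mul_pow, Real.sq_sqrt (Nat.cast_nonneg _), EuclideanSpace.norm_sq_eq]
  have := sq_sum_le_card_mul_sum_sq (s := Finset.univ) (f := fun k => |w k|)
  simpa using this

/-- The residual of the initial guess is controlled by the projection error of the history and the
extrapolation error of the solution. -/
theorem residual_le_of_extrapolation {𝕜 : Type*} [RCLike 𝕜] {n m M : ℕ}
    {A : Matrix (Fin n) (Fin n) 𝕜} (hA : IsUnit A) {b : Fin n → 𝕜}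
    {Q : Matrix (Fin n) (Fin m) 𝕜} {X : Matrix (Fin n) (Fin M) 𝕜} {ε : ℝ}
    (hQX : ‖(Q * Q.conjTranspose - 1) * X‖ ≤ ε) {s : Fin n → 𝕜} (hs : IsInitialGuess A b Q s)
    (w : EuclideanSpace ℝ (Fin M)) :
    euclNorm (A *ᵥ s - b) ≤
      ‖A‖ * (ε * ‖w‖ + euclNorm (solution A b - X *ᵥ fun k => (w k : 𝕜))) := by
  obtain ⟨z, rfl, hz⟩ := hs
  set u : Fin M → 𝕜 := fun k => (w k : 𝕜) with hu
  have hun : euclNorm u = ‖w‖ := by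
    simp [euclNorm, EuclideanSpace.norm_eq, hu]
  -- The competitor is the coordinate vector of the projection of `X w` onto the column space of
  -- `Q`.
  refine (hz (Q.conjTranspose *ᵥ (X *ᵥ u))).trans ?_
  have h1 : A *ᵥ (Q *ᵥ (Q.conjTranspose *ᵥ (X *ᵥ u))) - b =
      A *ᵥ (((Q * Q.conjTranspose - 1) * X) *ᵥ u + -(solution A b - X *ᵥ u)) := by
    conv_lhs => rw [← mulVec_solution hA b]
    rw [← mulVec_sub]
    congr 1
    simp only [Matrix.sub_mul, Matrix.one_mul, sub_mulVec, mulVec_mulVec, Matrix.mul_assoc]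
    abel
  rw [h1]
  refine (euclNorm_mulVec_le _ _).trans ?_
  gcongr
  refine (euclNorm_add_le _ _).trans ?_
  rw [euclNorm_neg]
  gcongr
  refine (euclNorm_mulVec_le _ _).trans ?_
  rw [hun]
  gcongr

theorem solutionMap_eq_of_eq_map {𝕜 : Type*} [RCLike 𝕜] {n : ℕ}
    {A : Matrix (Fin n) (Fin n) 𝕜} {b : Fin n → 𝕜}
    {Aext : ℂ → Matrix (Fin n) (Fin n) ℂ} {bext : ℂ → Fin n → ℂ} {t : ℂ}
    (hinv : IsUnit (Aext t))
    (hA : Aext t = A.map (RCLike.map 𝕜 ℂ)) (hb : bext t = fun j => RCLike.map 𝕜 ℂ (b j)) :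
    IsUnit A ∧
      solutionMap Aext bext t = WithLp.toLp 2 fun j => toComplexHom 𝕜 (solution A b j) := by
  have hA' : Aext t = A.map (toComplexHom 𝕜) := hA
  have hb' : bext t = fun j => toComplexHom 𝕜 (b j) := hb
  rw [hA'] at hinv
  have hU := isUnit_of_map_toComplexHom hinv
  exact ⟨hU, by rw [solutionMap, hA', hb', solution_map_toComplexHom hU]⟩

end CompressedGuess

open CompressedGuess in
theorem corollary1 {𝕜 : Type*} [RCLike 𝕜] {n m M R : ℕ} {ρ ε : ℝ}
    (hM : 2 ≤ M) (hρ : 1 < ρ) (hε : 0 < ε)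
    (A : ℝ → Matrix (Fin n) (Fin n) 𝕜) (b : ℝ → Fin n → 𝕜)
    (Aext : ℂ → Matrix (Fin n) (Fin n) ℂ) (bext : ℂ → Fin n → ℂ)
    (hext : HasAnalyticExtension ρ A b Aext bext)
    (hAnext : Aext (nextTime M) = (A (nextTime M)).map (RCLike.map 𝕜 ℂ))
    (hbnext : bext (nextTime M) = fun j => RCLike.map 𝕜 ℂ (b (nextTime M) j))
    (hr : ratio M ρ < 1)
    (Q : Matrix (Fin n) (Fin m) 𝕜) (hQ : Q.conjTranspose * Q = 1)
    (hQX : ‖(Q * Q.conjTranspose - 1) * historyMatrix M A b‖ ≤ ε)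
    (s : Fin n → 𝕜) (hs : IsInitialGuess (A (nextTime M)) (b (nextTime M)) Q s)
    (hR : (R : ℝ) ≤ 1 / 2 * √((M : ℝ) - 1)) :
    euclNorm ((A (nextTime M)).mulVec s - b (nextTime M)) ≤
      2 * ‖A (nextTime M)‖ * kappa ρ Aext bext *
        (1 / (1 - ratio M ρ) +
          constC M R * ρ / √(ρ ^ 2 * ratio M ρ ^ 2 - 1) *
            (1 / (ρ - 1) + ε * ρ ^ R / (2 * √(M : ℝ) * kappa ρ Aext bext))) *
        ratio M ρ ^ (R + 1) := by
  have hMr : (2 : ℝ) ≤ M := by exact_mod_cast hM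
  have hRM : 4 * R ^ 2 + 1 ≤ M := by
    have h1 : ((R : ℝ)) ^ 2 ≤ (1 / 2 * √((M : ℝ) - 1)) ^ 2 := by gcongr
    rw [mul_pow, Real.sq_sqrt (by linarith)] at h1
    have h2 : 4 * (R : ℝ) ^ 2 + 1 ≤ M := by linarith
    exact_mod_cast h2
  have hd := diffContOnCl_solutionMap hext.analytic_matrix hext.analytic_rhs
    hext.continuous_matrix hext.continuous_rhs hext.invertible
  have hmem := nextTime_mem_bernsteinEllipse hM hρ hr
  obtain ⟨hU, hsol⟩ := solutionMap_eq_of_eq_map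
    (hext.invertible _ (subset_closure hmem)) hAnext hbnext
  have hle := norm_solutionMap_le_kappa hd hmem
  set κ := kappa ρ Aext bext with hκdef
  have hκ : 0 ≤ κ := (norm_nonneg _).trans hle
  -- If `κ = 0`, the right-hand side is `0` whatever value the quotient by `κ` takes. Then `x(t_i) =
  -- 0`, so `b(t_i) = 0` and the competitor `0` has zero residual.
  rcases hκ.eq_or_lt with hκ0 | hκpos
  · have hx0 : solution (A (nextTime M)) (b (nextTime M)) = 0 := by
      rw [← hκ0] at hle
      have h1 := euclNorm_comp_toComplexHom (solution (A (nextTime M)) (b (nextTime M)))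
      rw [euclNorm, ← hsol, norm_le_zero_iff.1 hle, norm_zero] at h1
      simpa using norm_eq_zero.1 h1.symm
    have hb0 : b (nextTime M) = 0 := by
      rw [← mulVec_solution hU (b (nextTime M)), hx0, Matrix.mulVec_zero]
    obtain ⟨z, rfl, hz⟩ := hs
    have h0 := hz 0
    rw [← hκ0, mul_zero, zero_mul, zero_mul]
    refine h0.trans ?_
    simp [hb0, euclNorm]
  · obtain ⟨w, hw, hexact⟩ := exists_extrapolation_weights hM hRM
    have hres := residual_le_of_extrapolation hU hQX hs w
    have hext' := norm_solutionMap_sub_sum_le hρ hd hM hr w hexact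
    have hy : euclNorm (solution (A (nextTime M)) (b (nextTime M)) -
        (historyMatrix M A b).mulVec fun k => (w k : 𝕜)) =
        ‖solutionMap Aext bext (nextTime M) -
          ∑ k, (w k : ℂ) • solutionMap Aext bext (equiTime M k)‖ := by
      rw [← euclNorm_comp_toComplexHom, euclNorm]
      congr 1
      ext j
      have hcols : ∀ k, solutionMap Aext bext (equiTime M k) = WithLp.toLp 2 fun j =>
          toComplexHom 𝕜 (solution (A (equiTime M k)) (b (equiTime M k)) j) := fun k => by
        have hk := equiTime_mem_Icc hM k
        exact (solutionMap_eq_of_eq_map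
          (hext.invertible _ (subset_closure (ofReal_mem_bernsteinEllipse hρ hk)))
          (hext.extends_matrix _ hk) (hext.extends_rhs _ hk)).2
      have hreal : ∀ x : ℝ, toComplexHom 𝕜 (x : 𝕜) = x := fun x => by simp [toComplexHom]
      simp only [hsol, hcols, historyMatrix, Matrix.mulVec, dotProduct, Matrix.of_apply,
        Pi.sub_apply, map_sub, map_sum, map_mul, hreal, PiLp.sub_apply, WithLp.ofLp_sum,
        Finset.sum_apply, PiLp.smul_apply, smul_eq_mul, mul_comm]
    rw [hy] at hres
    have hτ := nextTime_eq hM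
    set τ := nextRadius M with hτdef
    set r := ratio M ρ with hrdef
    have hτr : τ = ρ * r := by
      have : r = τ / ρ := rfl
      rw [this]; field_simp
    have hρ0 : ρ ≠ 0 := by linarith
    have hρ1 : ρ - 1 ≠ 0 := by linarith
    have hρ1' : 0 < ρ - 1 := by linarith
    have hw1 := sum_abs_le_sqrt_mul_norm w
    have hsM : 0 < √(M : ℝ) := Real.sqrt_pos.2 (by linarith)
    have hinv : 2 * κ * ρ⁻¹ ^ (R + 1) / (1 - ρ⁻¹) = 2 * κ / (ρ ^ R * (ρ - 1)) := by
      rw [inv_pow, pow_succ]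
      field_simp
    rw [hinv] at hext'
    refine hres.trans ?_
    have hfac : 0 ≤ 2 * κ / (ρ ^ R * (ρ - 1)) := by positivity
    have hsq : √(ρ ^ 2 * r ^ 2 - 1) ≠ 0 := by
      rw [← mul_pow, ← hτr]
      exact (Real.sqrt_pos.2 (by nlinarith [hτ.1])).ne'
    rw [show τ ^ 2 = ρ ^ 2 * r ^ 2 by rw [hτr]; ring,
      show τ ^ (R + 1) = ρ ^ (R + 1) * r ^ (R + 1) by rw [hτr]; ring] at hw
    have h1r : 1 - r ≠ 0 := by linarith
    -- Projection error and grid truncation error are both proportional to `‖w‖`. Its factor `τ ^ (R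
    -- + 1) = ρ ^ (R + 1) r ^ (R + 1)` cancels `ρ ^ R` in the truncation term but leaves `ρ ^ R`
    -- next to `ε`.
    calc _ ≤ ‖A (nextTime M)‖ * (ε * ‖w‖ + (2 * κ * r ^ (R + 1) / (1 - r) +
            √M * ‖w‖ * (2 * κ / (ρ ^ R * (ρ - 1))))) := by
          gcongr
          exact hext'.trans (by gcongr)
      _ = ‖A (nextTime M)‖ * (2 * κ * r ^ (R + 1) / (1 - r) +
            (ε + √M * (2 * κ / (ρ ^ R * (ρ - 1)))) * ‖w‖) := by ring
      _ ≤ ‖A (nextTime M)‖ * (2 * κ * r ^ (R + 1) / (1 - r) +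
            (ε + √M * (2 * κ / (ρ ^ R * (ρ - 1)))) *
              (constC M R / √M * (ρ ^ (R + 1) * r ^ (R + 1)) / √(ρ ^ 2 * r ^ 2 - 1))) := by
          gcongr
      _ = _ := by
          field_simp
          ring
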